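/- Let $n\ge 2$ and let $K$ be a field. An $n$-Lie algebra over $K$ is a $K$-vector space with an alternating $n$-linear bracket satisfying \[[[x_1,\dots,x_n],y_2,\dots,y_n]=\sum_{i=1}^n[x_1,\dots,[x_i,y_2,\dots,y_n],\dots,x_n].\] For such an algebra $L$ put $L^1=L$ and $L^{i+1}=[L^i,L,\dots,L]$. Let $A(d)$ denote the abelian $n$-Lie algebra of dimension $d$ (zero bracket). For a free presentation $0\to R\to F\to L\to 0$, with $F$ a free $n$-Lie algebra, the $2$-nilpotent multiplier of $L$ is \[\mathcal M^{(2)}(L)=\frac{R\cap F^{3}}{[[R,F,\dots,F],F,\dots,F]}.\] Call $L$ Heisenberg if $L^2$ equals the center $Z(L)=\{z:[z,L,\dots,L]=0\}$ and $\dim L^2=1$. For $d\ge n$ and $w\ge 3$ put \[l_d^n(w)=\sum_{j=1}^{\binom{d-1}{n-1}}(d-n-j^*+2)\sum_{i=2}^{w-1}\binom{w-3}{i-2}\binom{\binom{d}{n-1}}{w-i},\] where $j^*=\binom{k-1}{n-1}+1$ for the $k$ with $\binom{k-1}{n-1}+1\le j\le\binom{k}{n-1}$. This is the counting formula for basic commutators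 of weight $w$ on $d$ letters; for $d=n$ it gives $l_n^n(3)=n$ and $l_n^n(4)=\binom n2+n$. **Theorem.** Let $H(n,1)$ be a Heisenberg $n$-Lie algebra of dimension $n+1$ over $K$. Then, for every free presentation of $H(n,1)$, there are isomorphisms of $n$-Lie algebras \[\mathcal M^{(2)}(H(n,1))\;\cong\; A\!\left(\frac{n^2+3n}{2}\right)\qquad\text{and}\qquad \mathcal M^{(2)}(H(n,1))\;\cong\; F^3/F^5,\] where in the second one $F$ is the free $n$-Lie algebra on $n$ letters. Moreover \[\dim F^3/F^5=l_n^n(3)+l_n^n(4)=\frac{n^2+3n}{2}.\] -/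

import Mathlib

/-- An `n`-Lie (Filippov) algebra structure on the `K`-vector space `L`: an `n`-linear alternating
bracket such that `[·, y₂, …, yₙ]` is a derivation of the bracket. The entries `y₂, …, yₙ` are the
entries of `y : Fin n → L` off position `0`; `Function.update y 0 z` is `(z, y₂, …, yₙ)`. -/
class NLieAlgebra (K : Type*) (n : ℕ) [NeZero n] (L : Type*) [Field K] [AddCommGroup L]
    [Module K L] where
  bracket : L [⋀^Fin n]→ₗ[K] L
  filippov : ∀ x y : Fin n → L,
    bracket (Function.update y 0 (bracket x)) =
      ∑ i, bracket (Function.update x i (bracket (Function.update y 0 (x i))))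

namespace NLie

section Basic

variable (K : Type*) (n : ℕ) [NeZero n] [Field K]
variable (L : Type*) [AddCommGroup L] [Module K L] [NLieAlgebra K n L]
variable (M : Type*) [AddCommGroup M] [Module K M] [NLieAlgebra K n M]

variable {n L} in
/-- The bracket `[x₁, …, xₙ]`. -/
def br (x : Fin n → L) : L := NLieAlgebra.bracket (K := K) x

/-- Homomorphisms of `n`-Lie algebras. -/
structure Hom extends L →ₗ[K] M where
  map_br : ∀ x : Fin n → L, toFun (br K x) = br K (fun i => toFun (x i))

/-- Isomorphisms of `n`-Lie algebras. -/
structure Iso extends L ≃ₗ[K] M where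
  map_br : ∀ x : Fin n → L, toFun (br K x) = br K (fun i => toFun (x i))

/-- An ideal: a subspace `I` with `[I, L, …, L] ⊆ I`. -/
structure Ideal extends Submodule K L where
  br_mem : ∀ x : Fin n → L, x 0 ∈ toSubmodule → br K x ∈ toSubmodule

variable {K n L M}

theorem filippov (x y : Fin n → L) :
    br K (Function.update y 0 (br K x)) =
      ∑ i, br K (Function.update x i (br K (Function.update y 0 (x i)))) :=
  NLieAlgebra.filippov x y

theorem br_swap (x : Fin n → L) {i j : Fin n} (h : i ≠ j) :
    br K (fun k => x (Equiv.swap i j k)) = -br K x := by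
  have := (NLieAlgebra.bracket (K := K) (n := n) (L := L)).map_swap x h
  exact this

/-- Because the bracket is alternating, an ideal absorbs brackets in every position. -/
theorem Ideal.br_mem' (I : Ideal K n L) (x : Fin n → L) (i : Fin n)
    (hx : x i ∈ I.toSubmodule) : br K x ∈ I.toSubmodule := by
  by_cases h : (0 : Fin n) = i
  · subst h; exact I.br_mem x hx
  · have h2 := I.br_mem (fun k => x (Equiv.swap 0 i k)) (by simpa using hx)
    rw [br_swap x h] at h2
    simpa using h2

/-- The whole algebra as an ideal. -/
def Ideal.top : Ideal K n L where
  toSubmodule := ⊤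
  br_mem _ _ := Submodule.mem_top

/-- The intersection of two ideals. -/
def Ideal.inter (I J : Ideal K n L) : Ideal K n L where
  toSubmodule := I.toSubmodule ⊓ J.toSubmodule
  br_mem x hx := ⟨I.br_mem x hx.1, J.br_mem x hx.2⟩

/-- The kernel of a homomorphism. -/
def Hom.ker (f : Hom K n L M) : Ideal K n L where
  toSubmodule := LinearMap.ker f.toLinearMap
  br_mem x hx := by
    have h1 : f.toFun (br K x) = br K (fun i => f.toFun (x i)) := f.map_br x
    have h2 : br K (fun i => f.toFun (x i)) = 0 :=
      (NLieAlgebra.bracket (K := K) (n := n) (L := M)).map_coord_zero (0 : Fin n) hx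
    exact h1.trans h2

/-- The ideal `[I, L, …, L]`. It is the linear span of the brackets `[x₁, …, xₙ]` with `x₁ ∈ I`;
this span is an ideal, so it is also the subalgebra generated by these brackets. -/
def Ideal.comm (I : Ideal K n L) : Ideal K n L where
  toSubmodule := Submodule.span K {z | ∃ x : Fin n → L, x 0 ∈ I.toSubmodule ∧ br K x = z}
  br_mem y hy := by
    set S := Submodule.span K {z | ∃ x : Fin n → L, x 0 ∈ I.toSubmodule ∧ br K x = z} with hS
    have gen : ∀ (x : Fin n → L) (i : Fin n), x i ∈ I.toSubmodule → br K x ∈ S := by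
      intro x i hx
      by_cases h : (0 : Fin n) = i
      · subst h; exact Submodule.subset_span ⟨x, hx, rfl⟩
      · have h2 : br K (fun k => x (Equiv.swap 0 i k)) ∈ S :=
          Submodule.subset_span ⟨_, by simpa using hx, rfl⟩
        rw [br_swap x h] at h2
        simpa using h2
    have key : S ≤ S.comap
        ((NLieAlgebra.bracket (K := K) (n := n) (L := L)).toMultilinearMap.toLinearMap y 0) := by
      refine Submodule.span_le.2 ?_
      rintro _ ⟨x, hx, rfl⟩
      change br K (Function.update y 0 (br K x)) ∈ S
      rw [filippov]
      refine Submodule.sum_mem _ fun i _ => ?_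
      by_cases h : i = 0
      · subst h
        refine gen _ 0 ?_
        rw [Function.update_self]
        exact I.br_mem _ (by simpa using hx)
      · exact gen _ 0 (by rw [Function.update_of_ne (Ne.symm h)]; exact hx)
    have := key hy
    change br K (Function.update y 0 (y 0)) ∈ S at this
    rwa [Function.update_eq_self] at this

/-- `I.gamma c` is `γ_{c+1}(I, L, …, L) = [[I, L, …, L], …, L, …, L]`, with `c` brackets. -/
def Ideal.gamma (I : Ideal K n L) : ℕ → Ideal K n L
  | 0 => I
  | c + 1 => (I.gamma c).comm

variable (K n L) in
/-- The lower central series: `lowerCentral K n L i` is `Lⁱ`, with `L¹ = L` and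
`Lⁱ⁺¹ = [Lⁱ, L, …, L]` for `i ≥ 1`. -/
def lowerCentral (i : ℕ) : Ideal K n L := Ideal.top.gamma (i - 1)

variable (K n L) in
/-- The center: all `z` with `[z, L, …, L] = 0`. -/
def center : Submodule K L where
  carrier := {z | ∀ y : Fin n → L, br K (Function.update y 0 z) = 0}
  zero_mem' y := (NLieAlgebra.bracket (K := K) (n := n) (L := L)).map_update_zero y 0
  add_mem' {a b} ha hb y := by
    have h : br K (Function.update y 0 (a + b)) =
        br K (Function.update y 0 a) + br K (Function.update y 0 b) :=
      (NLieAlgebra.bracket (K := K) (n := n) (L := L)).map_update_add y 0 a b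
    rw [h, ha y, hb y, add_zero]
  smul_mem' c a ha y := by
    have h : br K (Function.update y 0 (c • a)) = c • br K (Function.update y 0 a) :=
      (NLieAlgebra.bracket (K := K) (n := n) (L := L)).map_update_smul y 0 c a
    rw [h, ha y, smul_zero]

variable (K n L) in
/-- `L` is a Heisenberg `n`-Lie algebra: `L² = Z(L)` and `dim L² = 1`. -/
def IsHeisenberg : Prop :=
  (lowerCentral K n L 2).toSubmodule = center K n L ∧
    Module.finrank K (lowerCentral K n L 2).toSubmodule = 1

/-- An ideal is an `n`-Lie algebra with the restricted bracket. -/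
instance Ideal.instNLieAlgebra (I : Ideal K n L) : NLieAlgebra K n I.toSubmodule where
  bracket :=
    { toFun := fun x => ⟨br K (fun i => (x i : L)), I.br_mem _ (x 0).2⟩
      map_update_add' := by
        intro inst x i a b
        obtain rfl := Subsingleton.elim inst (instDecidableEqFin n)
        apply Subtype.ext
        have e : ∀ c : I.toSubmodule, (fun j => ((Function.update x i c) j : L)) =
            Function.update (fun j => (x j : L)) i c := by
          intro c; funext j; by_cases h : j = i
          · subst h; simp
          · simp [h]
        simp only [e, Submodule.coe_add]
        exact (NLieAlgebra.bracket (K := K) (n := n) (L := L)).map_update_add _ i _ _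
      map_update_smul' := by
        intro inst x i k a
        obtain rfl := Subsingleton.elim inst (instDecidableEqFin n)
        apply Subtype.ext
        have e : ∀ c : I.toSubmodule, (fun j => ((Function.update x i c) j : L)) =
            Function.update (fun j => (x j : L)) i c := by
          intro c; funext j; by_cases h : j = i
          · subst h; simp
          · simp [h]
        simp only [e, Submodule.coe_smul]
        exact (NLieAlgebra.bracket (K := K) (n := n) (L := L)).map_update_smul _ i _ _
      map_eq_zero_of_eq' := by
        intro x i j h hij
        apply Subtype.ext
        exact (NLieAlgebra.bracket (K := K) (n := n) (L := L)).map_eq_zero_of_eq _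
          (congrArg Subtype.val h) hij }
  filippov x y := by
    apply Subtype.ext
    have e : ∀ (x : Fin n → I.toSubmodule) (i : Fin n) (c : I.toSubmodule),
        (fun j => ((Function.update x i c) j : L)) = Function.update (fun j => (x j : L)) i c := by
      intro x i c; funext j; by_cases h : j = i
      · subst h; simp
      · simp [h]
    rw [Submodule.coe_sum]
    have h := filippov (K := K) (fun j => (x j : L)) (fun j => (y j : L))
    change br K (fun j => ((Function.update y 0 _) j : L)) =
      ∑ i, br K (fun j => ((Function.update x i _) j : L))
    simp only [e]
    refine h.trans (Finset.sum_congr rfl fun i _ => ?_)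
    congr 2
    change _ = br K (fun j => ((Function.update y 0 (x i)) j : L))
    rw [e]

/-- Two tuples that agree modulo an ideal have brackets that agree modulo the ideal. -/
theorem Ideal.br_sub_mem (I : Ideal K n L) (x y : Fin n → L)
    (h : ∀ i, x i - y i ∈ I.toSubmodule) : br K x - br K y ∈ I.toSubmodule := by
  classical
  have aux : ∀ s : Finset (Fin n), br K x - br K (s.piecewise y x) ∈ I.toSubmodule := by
    intro s
    induction s using Finset.induction_on with
    | empty => simp
    | insert i s hi ih =>
      have h1 : br K (s.piecewise y x) - br K ((insert i s).piecewise y x) ∈ I.toSubmodule := by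
        have e1 : s.piecewise y x = Function.update (s.piecewise y x) i (x i) := by
          rw [Function.eq_update_iff]
          simp [hi]
        rw [Finset.piecewise_insert]
        nth_rewrite 1 [e1]
        have h2 := (NLieAlgebra.bracket (K := K) (n := n) (L := L)).map_update_sub
          (s.piecewise y x) i (x i) (y i)
        change br K _ = br K _ - br K _ at h2
        rw [← h2]
        exact I.br_mem' _ i (by simpa using h i)
      simpa using I.toSubmodule.add_mem ih h1
  simpa using aux Finset.univ

/-- The quotient of an `n`-Lie algebra by an ideal; the bracket is `[x̄₁, …, x̄ₙ]`, the class of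
`[x₁, …, xₙ]` for any choice of representatives (see `quot_br_mk`). -/
noncomputable instance Ideal.instQuotient (I : Ideal K n L) :
    NLieAlgebra K n (L ⧸ I.toSubmodule) := by
  have key : ∀ x y : Fin n → L,
      (∀ i, (Submodule.Quotient.mk (x i) : L ⧸ I.toSubmodule) = Submodule.Quotient.mk (y i)) →
      (Submodule.Quotient.mk (br K x) : L ⧸ I.toSubmodule) = Submodule.Quotient.mk (br K y) :=
    fun x y h => (Submodule.Quotient.eq _).2
      (I.br_sub_mem x y fun i => (Submodule.Quotient.eq _).1 (h i))
  have out : ∀ q : L ⧸ I.toSubmodule, Submodule.Quotient.mk (Quotient.out q) = q :=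
    fun q => Quotient.out_eq q
  have upd : ∀ (x : Fin n → L ⧸ I.toSubmodule) (i : Fin n) (q : L ⧸ I.toSubmodule) (a : L),
      Submodule.Quotient.mk a = q → ∀ j, (Submodule.Quotient.mk
        (Quotient.out (Function.update x i q j)) : L ⧸ I.toSubmodule) =
        Submodule.Quotient.mk (Function.update (fun k => Quotient.out (x k)) i a j) := by
    intro x i q a ha j
    rw [out]
    by_cases h : j = i
    · subst h; simp [ha]
    · simp [h, out]
  exact
  { bracket :=
      { toFun := fun x => Submodule.Quotient.mk (br K (fun i => Quotient.out (x i)))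
        map_update_add' := by
          intro inst x i a b
          obtain rfl := Subsingleton.elim inst (instDecidableEqFin n)
          rw [key _ _ (upd x i (a + b) (Quotient.out a + Quotient.out b)
              (by rw [Submodule.Quotient.mk_add, out, out])),
            key _ _ (upd x i a _ (out a)), key _ _ (upd x i b _ (out b)),
            ← Submodule.Quotient.mk_add]
          congr 1
          exact (NLieAlgebra.bracket (K := K) (n := n) (L := L)).map_update_add _ i _ _
        map_update_smul' := by
          intro inst x i k a
          obtain rfl := Subsingleton.elim inst (instDecidableEqFin n)
          rw [key _ _ (upd x i (k • a) (k • Quotient.out a)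
              (by rw [Submodule.Quotient.mk_smul, out])),
            key _ _ (upd x i a _ (out a)), ← Submodule.Quotient.mk_smul]
          congr 1
          exact (NLieAlgebra.bracket (K := K) (n := n) (L := L)).map_update_smul _ i _ _
        map_eq_zero_of_eq' := by
          intro x i j h hij
          have h0 : br K (fun i => Quotient.out (x i)) = 0 :=
            (NLieAlgebra.bracket (K := K) (n := n) (L := L)).map_eq_zero_of_eq _
              (congrArg Quotient.out h) hij
          rw [h0, Submodule.Quotient.mk_zero] }
    filippov := by
      intro x y
      change (Submodule.Quotient.mk (br K (fun i => Quotient.out (Function.update y 0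
          (Submodule.Quotient.mk (br K (fun i => Quotient.out (x i)))) i))) : L ⧸ I.toSubmodule) =
        ∑ i, Submodule.Quotient.mk (br K (fun j => Quotient.out (Function.update x i
          (Submodule.Quotient.mk (br K (fun j => Quotient.out (Function.update y 0 (x i) j)))) j)))
      rw [key _ _ (upd y 0 _ _ rfl), filippov]
      rw [← Submodule.mkQ_apply, map_sum]
      refine Finset.sum_congr rfl fun i _ => ?_
      rw [Submodule.mkQ_apply]
      refine (key _ _ (upd x i _ _ ?_)).symm
      exact (key _ _ (upd y 0 _ _ (out _))).symm }

theorem quot_br_mk (I : Ideal K n L) (x : Fin n → L) :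
    br K (fun i => (Submodule.Quotient.mk (x i) : L ⧸ I.toSubmodule)) =
      Submodule.Quotient.mk (br K x) := by
  refine (Submodule.Quotient.eq _).2 (I.br_sub_mem _ _ fun i => (Submodule.Quotient.eq _).1 ?_)
  exact Quotient.out_eq _

/-- The ideal `J ∩ I` of the `n`-Lie algebra `I`. -/
def Ideal.restrict (I J : Ideal K n L) : Ideal K n I.toSubmodule where
  toSubmodule := J.toSubmodule.comap I.toSubmodule.subtype
  br_mem x hx := J.br_mem (fun i => (x i : L)) hx

/-- The `n`-Lie algebra `I / J` for ideals `J ⊆ I` of `L` (in general it is `I / (I ∩ J)`). -/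
abbrev Ideal.Section (I J : Ideal K n L) : Type _ :=
  I.toSubmodule ⧸ (I.restrict J).toSubmodule

end Basic

/-- The abelian `n`-Lie algebra `A(d)` of dimension `d`: the space `K^d` with zero bracket. -/
def Abelian (K : Type*) (_n d : ℕ) : Type _ := Fin d → K

section Abelian

variable (K : Type*) (n d : ℕ) [NeZero n] [Field K]

instance : AddCommGroup (Abelian K n d) := inferInstanceAs (AddCommGroup (Fin d → K))

instance : Module K (Abelian K n d) := inferInstanceAs (Module K (Fin d → K))

instance : NLieAlgebra K n (Abelian K n d) where
  bracket := 0
  filippov _ _ := by simp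

end Abelian

section Free

variable (K : Type*) (n : ℕ) [NeZero n] [Field K] (X : Type*)

/-- Formal expressions in the letters `X` and the operations of an `n`-Lie algebra. -/
inductive Pre : Type _
  | of (x : X) : Pre
  | zero : Pre
  | add (a b : Pre) : Pre
  | smul (k : K) (a : Pre) : Pre
  | brk (x : Fin n → Pre) : Pre

variable {K n X} in
/-- The congruence on expressions generated by the axioms of an `n`-Lie algebra. -/
inductive Rel : Pre K n X → Pre K n X → Prop
  | refl (a) : Rel a a
  | symm {a b} : Rel a b → Rel b a
  | trans {a b c} : Rel a b → Rel b c → Rel a c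
  | add_congr {a a' b b'} : Rel a a' → Rel b b' → Rel (.add a b) (.add a' b')
  | smul_congr (k) {a a'} : Rel a a' → Rel (.smul k a) (.smul k a')
  | brk_congr {x x' : Fin n → Pre K n X} : (∀ i, Rel (x i) (x' i)) → Rel (.brk x) (.brk x')
  | add_comm (a b) : Rel (.add a b) (.add b a)
  | add_assoc (a b c) : Rel (.add (.add a b) c) (.add a (.add b c))
  | zero_add (a) : Rel (.add .zero a) a
  | smul_add (k a b) : Rel (.smul k (.add a b)) (.add (.smul k a) (.smul k b))
  | add_smul (k l a) : Rel (.smul (k + l) a) (.add (.smul k a) (.smul l a))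
  | mul_smul (k l a) : Rel (.smul (k * l) a) (.smul k (.smul l a))
  | one_smul (a) : Rel (.smul 1 a) a
  | zero_smul (a) : Rel (.smul 0 a) .zero
  | brk_add (x : Fin n → Pre K n X) (i a b) : Rel (.brk (Function.update x i (.add a b)))
      (.add (.brk (Function.update x i a)) (.brk (Function.update x i b)))
  | brk_smul (x : Fin n → Pre K n X) (i k a) : Rel (.brk (Function.update x i (.smul k a)))
      (.smul k (.brk (Function.update x i a)))
  | brk_alt (x : Fin n → Pre K n X) (i j) : i ≠ j → x i = x j → Rel (.brk x) .zero
  | filippov (x y : Fin n → Pre K n X) :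
      Rel (.brk (Function.update y 0 (.brk x)))
        ((List.ofFn fun i => Pre.brk (Function.update x i
          (.brk (Function.update y 0 (x i))))).foldr .add .zero)

/-- The congruence as a setoid. -/
def relSetoid : Setoid (Pre K n X) := ⟨Rel, Rel.refl, Rel.symm, Rel.trans⟩

/-- The free `n`-Lie algebra over `K` on the set `X`. -/
def Free : Type _ := Quotient (relSetoid K n X)

namespace Free

variable {K n X}

/-- The class of an expression. -/
def mk (a : Pre K n X) : Free K n X := Quotient.mk (relSetoid K n X) a

theorem sound {a b : Pre K n X} (h : Rel a b) : mk a = mk b :=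
  Quotient.sound (s := relSetoid K n X) h

theorem rel_of_eq {a b : Pre K n X} (h : mk a = mk b) : Rel a b :=
  Quotient.exact (s := relSetoid K n X) h

/-- A representative of a class. -/
noncomputable def rep (q : Free K n X) : Pre K n X := Quotient.out (s := relSetoid K n X) q

theorem mk_rep (q : Free K n X) : mk (rep q) = q := Quotient.out_eq (s := relSetoid K n X) q

/-- The generator `x`. -/
def of (x : X) : Free K n X := mk (.of x)

instance : Zero (Free K n X) := ⟨mk .zero⟩

instance : Add (Free K n X) :=
  ⟨Quotient.map₂ (sa := relSetoid K n X) (sb := relSetoid K n X) (sc := relSetoid K n X) Pre.add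
    fun _ _ h _ _ h' => Rel.add_congr h h'⟩

instance : SMul K (Free K n X) :=
  ⟨fun k => Quotient.map (sa := relSetoid K n X) (sb := relSetoid K n X) (Pre.smul k)
    fun _ _ h => Rel.smul_congr k h⟩

theorem mk_add (a b : Pre K n X) : mk (.add a b) = mk a + mk b := rfl

theorem mk_smul (k : K) (a : Pre K n X) : mk (.smul k a) = k • mk a := rfl

theorem mk_zero : mk (.zero : Pre K n X) = 0 := rfl

theorem ind {p : Free K n X → Prop} (h : ∀ a, p (mk a)) (q : Free K n X) : p q := by
  rw [← mk_rep q]; exact h _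

theorem zero_smul' (a : Free K n X) : (0 : K) • a = 0 := by
  induction a using ind with | h a => exact sound (.zero_smul a)

theorem add_smul' (k l : K) (a : Free K n X) : (k + l) • a = k • a + l • a := by
  induction a using ind with | h a => exact sound (.add_smul k l a)

theorem one_smul' (a : Free K n X) : (1 : K) • a = a := by
  induction a using ind with | h a => exact sound (.one_smul a)

theorem mul_smul' (k l : K) (a : Free K n X) : (k * l) • a = k • l • a := by
  induction a using ind with | h a => exact sound (.mul_smul k l a)

theorem add_comm' (a b : Free K n X) : a + b = b + a := by
  induction a using ind with | h a =>
  induction b using ind with | h b => exact sound (.add_comm a b)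

theorem zero_add' (a : Free K n X) : 0 + a = a := by
  induction a using ind with | h a => exact sound (.zero_add a)

instance : Neg (Free K n X) := ⟨fun a => (-1 : K) • a⟩

instance : AddCommGroup (Free K n X) where
  add_assoc a b c := by
    induction a using ind with | h a =>
    induction b using ind with | h b =>
    induction c using ind with | h c => exact sound (.add_assoc a b c)
  zero_add := zero_add'
  add_zero a := (add_comm' a 0).trans (zero_add' a)
  add_comm := add_comm'
  neg_add_cancel a := by
    change (-1 : K) • a + a = 0
    nth_rewrite 2 [← one_smul' a]
    rw [← add_smul', neg_add_cancel, zero_smul']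
  nsmul := nsmulRec
  zsmul := zsmulRec

instance : Module K (Free K n X) where
  one_smul := one_smul'
  mul_smul := mul_smul'
  smul_zero k := by
    rw [← zero_smul' (0 : Free K n X), ← mul_smul', mul_zero]
  smul_add k a b := by
    induction a using ind with | h a =>
    induction b using ind with | h b => exact sound (.smul_add k a b)
  add_smul := add_smul'
  zero_smul := zero_smul'

theorem mk_brk_eq {x y : Fin n → Pre K n X} (h : ∀ i, mk (x i) = mk (y i)) :
    mk (.brk x) = mk (.brk y) := sound (.brk_congr fun i => rel_of_eq (h i))

theorem mk_rep_update (x : Fin n → Free K n X) (i : Fin n) (q : Free K n X) (a : Pre K n X)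
    (ha : mk a = q) (j : Fin n) :
    mk (rep (Function.update x i q j)) = mk (Function.update (fun k => rep (x k)) i a j) := by
  rw [mk_rep]
  by_cases h : j = i
  · subst h; simp [ha]
  · simp [h, mk_rep]

theorem mk_foldr (l : List (Pre K n X)) : mk (l.foldr .add .zero) = (l.map mk).sum := by
  induction l with
  | nil => rfl
  | cons a l ih => simp [mk_add, ih]

noncomputable instance : NLieAlgebra K n (Free K n X) where
  bracket :=
    { toFun := fun x => mk (.brk fun i => rep (x i))
      map_update_add' := by
        intro inst x i a b
        obtain rfl := Subsingleton.elim inst (instDecidableEqFin n)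
        rw [mk_brk_eq (mk_rep_update x i (a + b) (.add (rep a) (rep b))
            (by rw [mk_add, mk_rep, mk_rep])),
          mk_brk_eq (mk_rep_update x i a _ (mk_rep a)),
          mk_brk_eq (mk_rep_update x i b _ (mk_rep b))]
        exact sound (.brk_add _ i _ _)
      map_update_smul' := by
        intro inst x i k a
        obtain rfl := Subsingleton.elim inst (instDecidableEqFin n)
        rw [mk_brk_eq (mk_rep_update x i (k • a) (.smul k (rep a)) (by rw [mk_smul, mk_rep])),
          mk_brk_eq (mk_rep_update x i a _ (mk_rep a))]
        exact sound (.brk_smul _ i _ _)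
      map_eq_zero_of_eq' := by
        intro x i j h hij
        exact sound (.brk_alt _ i j hij (congrArg rep h)) }
  filippov := by
    intro x y
    change mk (.brk fun j => rep (Function.update y 0 (mk (.brk fun i => rep (x i))) j)) =
      ∑ i, mk (.brk fun j => rep (Function.update x i
        (mk (.brk fun j => rep (Function.update y 0 (x i) j))) j))
    rw [mk_brk_eq (mk_rep_update y 0 _ _ rfl), sound (.filippov _ _), mk_foldr, List.map_ofFn,
      List.sum_ofFn]
    refine Finset.sum_congr rfl fun i _ => ?_
    refine (mk_brk_eq (mk_rep_update x i _ _ ?_)).symm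
    exact (mk_brk_eq (mk_rep_update y 0 _ _ (mk_rep _))).symm

theorem br_mk (x : Fin n → Pre K n X) : br K (fun i => mk (x i)) = mk (.brk x) :=
  mk_brk_eq fun _ => mk_rep _

/-! The universal property of the free `n`-Lie algebra. -/

variable {L : Type*} [AddCommGroup L] [Module K L] [NLieAlgebra K n L]

/-- Evaluation of expressions in an `n`-Lie algebra. -/
def eval (f : X → L) : Pre K n X → L
  | .of x => f x
  | .zero => 0
  | .add a b => eval f a + eval f b
  | .smul k a => k • eval f a
  | .brk x => br K fun i => eval f (x i)

theorem eval_update (f : X → L) (x : Fin n → Pre K n X) (i : Fin n) (a : Pre K n X) :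
    (fun j => eval f (Function.update x i a j)) =
      Function.update (fun j => eval f (x j)) i (eval f a) := by
  funext j
  by_cases h : j = i
  · subst h; simp
  · simp [h]

theorem eval_foldr (f : X → L) (l : List (Pre K n X)) :
    eval f (l.foldr .add .zero) = (l.map (eval f)).sum := by
  induction l with
  | nil => rfl
  | cons a l ih => simp [eval, ih]

theorem eval_rel (f : X → L) {a b : Pre K n X} (h : Rel a b) : eval f a = eval f b := by
  induction h with
  | refl => rfl
  | symm _ ih => exact ih.symm
  | trans _ _ ih ih' => exact ih.trans ih'
  | add_congr _ _ ih ih' => simp only [eval, ih, ih']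
  | smul_congr k _ ih => simp only [eval, ih]
  | brk_congr _ ih => simp only [eval, ih]
  | add_comm => exact _root_.add_comm _ _
  | add_assoc => exact _root_.add_assoc _ _ _
  | zero_add => exact _root_.zero_add _
  | smul_add => exact _root_.smul_add _ _ _
  | add_smul => exact _root_.add_smul _ _ _
  | mul_smul => exact SemigroupAction.mul_smul _ _ _
  | one_smul => exact _root_.one_smul _ _
  | zero_smul => exact _root_.zero_smul _ _
  | brk_add x i a b =>
    simp only [eval, eval_update]
    exact (NLieAlgebra.bracket (K := K) (n := n) (L := L)).map_update_add _ i _ _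
  | brk_smul x i k a =>
    simp only [eval, eval_update]
    exact (NLieAlgebra.bracket (K := K) (n := n) (L := L)).map_update_smul _ i _ _
  | brk_alt x i j hij h =>
    exact (NLieAlgebra.bracket (K := K) (n := n) (L := L)).map_eq_zero_of_eq _
      (congrArg (eval f) h) hij
  | filippov x y =>
    rw [eval_foldr, List.map_ofFn, List.sum_ofFn]
    simp only [eval, eval_update, Function.comp_def]
    exact NLie.filippov _ _

/-- Every map from `X` to an `n`-Lie algebra extends to a homomorphism. -/
def lift (f : X → L) : Hom K n (Free K n X) L where
  toFun := Quotient.lift (s := relSetoid K n X) (eval f) fun _ _ h => eval_rel f h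
  map_add' a b := by
    induction a using ind with | h a =>
    induction b using ind with | h b => rfl
  map_smul' k a := by
    induction a using ind with | h a => rfl
  map_br x := by
    have hx : x = fun i => mk (rep (x i)) := funext fun i => (mk_rep (x i)).symm
    rw [hx, br_mk]
    rfl

theorem lift_of (f : X → L) (x : X) : (lift f : Hom K n (Free K n X) L).toLinearMap (of x) = f x :=
  rfl

/-- The extension is unique. -/
theorem hom_ext {f g : Hom K n (Free K n X) L}
    (h : ∀ x, f.toLinearMap (of x) = g.toLinearMap (of x)) : f.toLinearMap = g.toLinearMap := by
  ext q
  induction q using ind with | h a =>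
  induction a with
  | of x => exact h x
  | zero => rw [mk_zero, map_zero, map_zero]
  | add a b iha ihb => rw [mk_add, map_add, map_add, iha, ihb]
  | smul k a ih => rw [mk_smul, map_smul, map_smul, ih]
  | brk x ih =>
    rw [← br_mk]
    have h1 := f.map_br fun i => mk (x i)
    have h2 := g.map_br fun i => mk (x i)
    exact h1.trans ((congrArg (br K) (funext ih)).trans h2.symm)

end Free

end Free

section Multiplier

variable {K : Type*} {n : ℕ} [NeZero n] [Field K] {X : Type*}
variable {L : Type*} [AddCommGroup L] [Module K L] [NLieAlgebra K n L]

/-- The `c`-nilpotent multiplier `(R ∩ F^{c+1}) / γ_{c+1}(R, F, …, F)` of `L`, computed from the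
free presentation `0 → R → F → L → 0` given by `π : F → L` with kernel `R`. -/
abbrev Multiplier (c : ℕ) (π : Hom K n (Free K n X) L) : Type _ :=
  (π.ker.inter (lowerCentral K n (Free K n X) (c + 1))).Section (π.ker.gamma c)

end Multiplier

/-- The index `j*`: the number `C(k-1, n-1) + 1` for the `k` with
`C(k-1, n-1) + 1 ≤ j ≤ C(k, n-1)`; here `m = k - 1` is the largest `m ≤ d - 2` with
`C(m, n-1) < j`. -/
def jStar (n d j : ℕ) : ℕ :=
  (Nat.findGreatest (fun m => m.choose (n - 1) < j) (d - 2)).choose (n - 1) + 1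

/-- The number `l_d^n(w)` of basic commutators of weight `w ≥ 3` on `d` letters in `n`-Lie algebras,
as given by the counting formula
`∑_{j=1}^{C(d-1,n-1)} (d - n - j* + 2) ∑_{i=2}^{w-1} C(w-3,i-2) C(C(d,n-1), w-i)`. -/
def basicCount (n d w : ℕ) : ℤ :=
  ∑ j ∈ Finset.Icc 1 ((d - 1).choose (n - 1)), ((d : ℤ) - n - jStar n d j + 2) *
    ∑ i ∈ Finset.Icc 2 (w - 1), ((w - 3).choose (i - 2) * (d.choose (n - 1)).choose (w - i) : ℕ)

end NLie

/-! The multiplier does not depend on the free presentation. Two presentations map to each other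
over `L`, and each round trip is an endomorphism congruent to the identity modulo `R`. Such an
endomorphism moves elements of `F³` only by `[[R, F, …, F], F, …, F]` (`Hom.sub_mem_gamma_two`,
`multiplier_iso`). A convenient presentation is therefore enough: a Heisenberg algebra of dimension
`n + 1` is `F / F³` with `F` free on `n` letters (`IsHeisenberg.exists_presentation`). With `R = F³`
the multiplier is literally `F³ / F⁵`, whose bracket vanishes because `[F³, F², F, …, F] ⊆ F⁵`.

It remains to find `dim F³ / F⁵`. For the upper bound, let `op j` replace the letter `x_j` in `[x₁,
…, xₙ]`. Modulo `F⁵`, the space `F³` is spanned by the values `op j word` and `op i (op j word)`;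
since `op_comm` makes the order irrelevant, they are indexed by letters and unordered pairs of
letters.

For independence, map `F` to `K[X₁, …, Xₙ]ⁿ` with bracket `det (a₁, …, aₙ) • (X₁, …, Xₙ)`, an
`n`-Lie algebra by Cramer's rule. On the words, `op j` becomes multiplication by `X_j`, so they map
to distinct monomials times the vector `X`, while `F⁵` lands in degree at least 4. This works over
every field. -/

namespace NLie

/-! ### Brackets, ideals and maps between sections. -/

section Basic

variable {K : Type*} {n : ℕ} [NeZero n] [Field K]
variable {L : Type*} [AddCommGroup L] [Module K L] [NLieAlgebra K n L]
variable {M : Type*} [AddCommGroup M] [Module K M] [NLieAlgebra K n M]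

/-- The bracket as a linear function of its entry in position `i`. -/
def brLin (x : Fin n → L) (i : Fin n) : L →ₗ[K] L :=
  (NLieAlgebra.bracket (K := K) (n := n) (L := L)).toMultilinearMap.toLinearMap x i

theorem brLin_apply (x : Fin n → L) (i : Fin n) (z : L) :
    brLin (K := K) x i z = br K (Function.update x i z) := rfl

theorem br_eq_zero_of_eq (x : Fin n → L) {i j : Fin n} (h : x i = x j) (hij : i ≠ j) :
    br K x = 0 :=
  (NLieAlgebra.bracket (K := K) (n := n) (L := L)).map_eq_zero_of_eq x h hij

theorem br_perm (x : Fin n → L) (σ : Equiv.Perm (Fin n)) :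
    br K (x ∘ σ) = Equiv.Perm.sign σ • br K x :=
  (NLieAlgebra.bracket (K := K) (n := n) (L := L)).map_perm x σ

theorem br_update_swap (y : Fin n → L) {k : Fin n} (hk : 0 ≠ k) (z : L) :
    br K (Function.update y k z) = -br K (Function.update (y ∘ Equiv.swap 0 k) 0 z) := by
  rw [← br_swap _ hk, ← neg_neg (br K (Function.update y k z)), ← br_swap _ hk, ← br_swap _ hk]
  congr 1
  funext j
  rcases eq_or_ne j 0 with rfl | h0
  · simp [hk, hk.symm]
  rcases eq_or_ne j k with rfl | h1
  · simp
  · simp [Equiv.swap_apply_of_ne_of_ne h0 h1, h0, h1]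

/-- The Filippov identity with the inner bracket in an arbitrary position. -/
theorem filippov_at (k : Fin n) (x y : Fin n → L) :
    br K (Function.update y k (br K x)) =
      ∑ i, br K (Function.update x i (br K (Function.update y k (x i)))) := by
  by_cases hk : 0 = k
  · subst hk; exact filippov x y
  · simp only [br_update_swap y hk]
    rw [filippov, ← Finset.sum_neg_distrib]
    exact Finset.sum_congr rfl fun i _ => (map_neg (brLin (K := K) x i) _).symm

theorem Ideal.ext' {I J : Ideal K n L} (h : I.toSubmodule = J.toSubmodule) : I = J := by
  cases I; cases J; cases h; rfl

theorem Ideal.br_mem_comm (I : Ideal K n L) (x : Fin n → L) (i : Fin n)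
    (hx : x i ∈ I.toSubmodule) : br K x ∈ I.comm.toSubmodule := by
  by_cases h : (0 : Fin n) = i
  · subst h; exact Submodule.subset_span ⟨x, hx, rfl⟩
  · have h2 : br K (fun k => x (Equiv.swap 0 i k)) ∈ I.comm.toSubmodule :=
      Submodule.subset_span ⟨_, by simpa using hx, rfl⟩
    rw [br_swap x h] at h2
    simpa using h2

theorem Ideal.comm_le (I : Ideal K n L) (W : Submodule K L)
    (h : ∀ x : Fin n → L, x 0 ∈ I.toSubmodule → br K x ∈ W) : I.comm.toSubmodule ≤ W :=
  Submodule.span_le.2 fun _ ⟨x, hx, e⟩ => e ▸ h x hx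

theorem Ideal.comm_le_self (I : Ideal K n L) : I.comm.toSubmodule ≤ I.toSubmodule :=
  I.comm_le _ I.br_mem

/-- `[I, L², L, …, L] ⊆ [[I, L, …, L], L, …, L]`. -/
theorem Ideal.br_mem_comm_comm (I : Ideal K n L) (x : Fin n → L) {i j : Fin n} (hij : i ≠ j)
    (hi : x i ∈ I.toSubmodule) (hj : x j ∈ (Ideal.top : Ideal K n L).comm.toSubmodule) :
    br K x ∈ I.comm.comm.toSubmodule := by
  have key : (Ideal.top : Ideal K n L).comm.toSubmodule ≤
      I.comm.comm.toSubmodule.comap (brLin (K := K) x j) := by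
    -- With `x j = [z₁, …, zₙ]`, the Filippov identity moves the other entries of `x` inside, next
    -- to each `z l`. The inner bracket still contains `x i ∈ I`, so it lies in `[I, L, …, L]`, and
    -- the outer bracket adds one more commutator.
    refine Ideal.comm_le _ _ fun z _ => ?_
    rw [Submodule.mem_comap, brLin_apply, filippov_at]
    refine Submodule.sum_mem _ fun l _ => Ideal.br_mem_comm _ _ l ?_
    rw [Function.update_self]
    refine Ideal.br_mem_comm _ _ i ?_
    rwa [Function.update_of_ne hij]
  have := key hj
  rwa [Submodule.mem_comap, brLin_apply, Function.update_eq_self] at this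

/-- A difference of brackets, as a telescoping sum. -/
theorem br_sub_mem_of_update (W : Submodule K L) (x y : Fin n → L)
    (h : ∀ i w, (∀ j, w j = x j ∨ w j = y j) → br K (Function.update w i (x i - y i)) ∈ W) :
    br K x - br K y ∈ W := by
  classical
  have aux : ∀ s : Finset (Fin n), br K x - br K (s.piecewise y x) ∈ W := by
    intro s
    induction s using Finset.induction_on with
    | empty => simp
    | insert i s hi ih =>
      have h1 : br K (s.piecewise y x) - br K ((insert i s).piecewise y x) ∈ W := by
        have e1 : s.piecewise y x = Function.update (s.piecewise y x) i (x i) := by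
          rw [Function.eq_update_iff]
          simp [hi]
        rw [Finset.piecewise_insert]
        nth_rewrite 1 [e1]
        rw [← brLin_apply, ← brLin_apply, ← map_sub, brLin_apply]
        refine h i _ fun j => ?_
        by_cases hj : j ∈ s <;> simp [hj]
      simpa using W.add_mem ih h1
  simpa using aux Finset.univ

theorem Hom.map_br' (f : Hom K n L M) (x : Fin n → L) :
    f.toLinearMap (br K x) = br K fun i => f.toLinearMap (x i) := f.map_br x

theorem Hom.map_comm (f : Hom K n L M) {I : Ideal K n L} {J : Ideal K n M}
    (h : ∀ u ∈ I.toSubmodule, f.toLinearMap u ∈ J.toSubmodule) :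
    ∀ u ∈ I.comm.toSubmodule, f.toLinearMap u ∈ J.comm.toSubmodule := by
  have : I.comm.toSubmodule ≤ J.comm.toSubmodule.comap f.toLinearMap := by
    refine I.comm_le _ fun x hx => ?_
    rw [Submodule.mem_comap, f.map_br']
    exact J.br_mem_comm _ 0 (h _ hx)
  exact this

theorem Hom.map_gamma (f : Hom K n L M) {I : Ideal K n L} {J : Ideal K n M}
    (h : ∀ u ∈ I.toSubmodule, f.toLinearMap u ∈ J.toSubmodule) (c : ℕ) :
    ∀ u ∈ (I.gamma c).toSubmodule, f.toLinearMap u ∈ (J.gamma c).toSubmodule := by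
  induction c with
  | zero => exact h
  | succ c ih => exact f.map_comm ih

/-- An endomorphism congruent to the identity modulo `R` is congruent to it on `L²` modulo
`[R, L, …, L]`. -/
theorem Hom.sub_mem_comm (h : L → L) (hbr : ∀ x : Fin n → L, h (br K x) = br K fun i => h (x i))
    (R : Ideal K n L) (hR : ∀ u, h u - u ∈ R.toSubmodule) (x : Fin n → L) :
    h (br K x) - br K x ∈ R.comm.toSubmodule := by
  rw [hbr]
  refine br_sub_mem_of_update _ _ _ fun i w _ => R.br_mem_comm _ i ?_
  rw [Function.update_self]
  exact hR _

/-- An endomorphism congruent to the identity modulo `R` is congruent to it on `L³` modulo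
`[[R, L, …, L], L, …, L]`. -/
theorem Hom.sub_mem_gamma_two (h : Hom K n L L) (R : Ideal K n L)
    (hR : ∀ u, h.toLinearMap u - u ∈ R.toSubmodule) (u : L)
    (hu : u ∈ (lowerCentral K n L 3).toSubmodule) :
    h.toLinearMap u - u ∈ (R.gamma 2).toSubmodule := by
  have h2 : (Ideal.top : Ideal K n L).comm.toSubmodule ≤
      R.comm.toSubmodule.comap (h.toLinearMap - LinearMap.id) :=
    Ideal.comm_le _ _ fun x _ => Hom.sub_mem_comm _ h.map_br' R hR x
  have h3 : (Ideal.top : Ideal K n L).comm.comm.toSubmodule ≤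
      R.comm.comm.toSubmodule.comap (h.toLinearMap - LinearMap.id) := by
    refine Ideal.comm_le _ _ fun x hx => ?_
    change h.toLinearMap (br K x) - br K x ∈ R.comm.comm.toSubmodule
    rw [h.map_br']
    refine br_sub_mem_of_update _ _ _ fun i w hw => ?_
    -- At position `0` the difference is already in `[R, L, …, L]`, by the weight-two case. At any
    -- other position it is only in `R`, but the entry at `0` is in `L²` and supplies the missing
    -- commutator.
    by_cases hi : i = 0
    · subst hi
      refine Ideal.br_mem_comm _ _ 0 ?_
      rw [Function.update_self]
      exact h2 hx
    · refine R.br_mem_comm_comm _ (i := i) (j := 0) hi ?_ ?_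
      · rw [Function.update_self]
        exact hR _
      · rw [Function.update_of_ne (Ne.symm hi)]
        rcases hw 0 with e | e <;> rw [e]
        · exact h.map_comm (J := Ideal.top) (fun _ _ => Submodule.mem_top) _ hx
        · exact hx
  exact h3 hu

/-- The map `I / J → I' / J'` induced by a homomorphism. -/
def Hom.sectionMap (f : Hom K n L M) (I J : Ideal K n L) (I' J' : Ideal K n M)
    (hI : ∀ u ∈ I.toSubmodule, f.toLinearMap u ∈ I'.toSubmodule)
    (hJ : ∀ u ∈ J.toSubmodule, f.toLinearMap u ∈ J'.toSubmodule) :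
    I.Section J →ₗ[K] I'.Section J' :=
  Submodule.mapQ _ _ (f.toLinearMap.restrict hI) fun u hu => hJ u.1 hu

/-- Homomorphisms that are mutually inverse modulo `J` and `J'` give an isomorphism
`I / J ≅ I' / J'`. -/
def sectionIso (f : Hom K n L M) (g : Hom K n M L) (I J : Ideal K n L) (I' J' : Ideal K n M)
    (hI : ∀ u ∈ I.toSubmodule, f.toLinearMap u ∈ I'.toSubmodule)
    (hJ : ∀ u ∈ J.toSubmodule, f.toLinearMap u ∈ J'.toSubmodule)
    (hI' : ∀ u ∈ I'.toSubmodule, g.toLinearMap u ∈ I.toSubmodule)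
    (hJ' : ∀ u ∈ J'.toSubmodule, g.toLinearMap u ∈ J.toSubmodule)
    (hgf : ∀ u ∈ I.toSubmodule, g.toLinearMap (f.toLinearMap u) - u ∈ J.toSubmodule)
    (hfg : ∀ u ∈ I'.toSubmodule, f.toLinearMap (g.toLinearMap u) - u ∈ J'.toSubmodule) :
    Iso K n (I.Section J) (I'.Section J') where
  toLinearEquiv := LinearEquiv.ofLinearMap (f.sectionMap I J I' J' hI hJ)
    (g.sectionMap I' J' I J hI' hJ')
    (by
      ext u
      exact (Submodule.Quotient.eq _).2 (hfg u.1 u.2))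
    (by
      ext u
      exact (Submodule.Quotient.eq _).2 (hgf u.1 u.2))
  map_br x := by
    obtain ⟨y, rfl⟩ : ∃ y : Fin n → I.toSubmodule, x = fun i => Submodule.Quotient.mk (y i) :=
      ⟨fun i => (x i).out, funext fun i => (Quotient.out_eq _).symm⟩
    change (f.sectionMap I J I' J' hI hJ) (br K fun i => Submodule.Quotient.mk (y i)) =
      br K fun i => Submodule.Quotient.mk (f.toLinearMap.restrict hI (y i))
    rw [quot_br_mk, quot_br_mk]
    change Submodule.Quotient.mk _ = _
    congr 1
    exact Subtype.ext (f.map_br' _)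

/-- A linear isomorphism between algebras with zero bracket is an isomorphism. -/
def isoOfBrZero (e : L ≃ₗ[K] M) (hL : ∀ x : Fin n → L, br K x = 0)
    (hM : ∀ x : Fin n → M, br K x = 0) : Iso K n L M where
  toLinearEquiv := e
  map_br x := by
    rw [hL, hM]
    exact map_zero e

theorem Iso.nonempty_trans {N : Type*} [AddCommGroup N] [Module K N] [NLieAlgebra K n N]
    (e : Iso K n L M) (e' : Iso K n M N) : Nonempty (Iso K n L N) :=
  ⟨{ toLinearEquiv := e.toLinearEquiv.trans e'.toLinearEquiv
     map_br := fun x => (congrArg e'.toFun (e.map_br x)).trans (e'.map_br _) }⟩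

/-- The bracket of `F³ / F⁵` vanishes. -/
theorem br_section_eq_zero (hn : 2 ≤ n)
    (x : Fin n → (lowerCentral K n L 3).Section (lowerCentral K n L 5)) : br K x = 0 := by
  obtain ⟨y, rfl⟩ : ∃ y : Fin n → (lowerCentral K n L 3).toSubmodule,
      x = fun i => Submodule.Quotient.mk (y i) :=
    ⟨fun i => (x i).out, funext fun i => (Quotient.out_eq _).symm⟩
  rw [quot_br_mk, Submodule.Quotient.mk_eq_zero]
  -- Two of the entries suffice: one in `F³`, the other merely in `F²`. The second position exists
  -- because `n ≥ 2`.
  exact Ideal.br_mem_comm_comm (Ideal.top.comm.comm) (fun i => (y i : L))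
    (i := ⟨0, by omega⟩) (j := ⟨1, by omega⟩) (by simp) (y _).2 (Ideal.comm_le_self _ (y _).2)

end Basic

/-! ### Independence of the free presentation. -/

section Multiplier

variable {K : Type*} {n : ℕ} [NeZero n] [Field K] {X Y : Type*}
variable {L : Type*} [AddCommGroup L] [Module K L] [NLieAlgebra K n L]

/-- Homomorphisms from a free algebra lift along surjections. -/
theorem Free.exists_lift {M : Type*} [AddCommGroup M] [Module K M] [NLieAlgebra K n M]
    (f : Hom K n (Free K n X) L) (g : Hom K n M L) (hg : Function.Surjective g.toLinearMap) :
    ∃ h : Hom K n (Free K n X) M, ∀ u, g.toLinearMap (h.toLinearMap u) = f.toLinearMap u := by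
  choose s hs using hg
  let h : Hom K n (Free K n X) M := Free.lift fun x => s (f.toLinearMap (Free.of x))
  let gh : Hom K n (Free K n X) L :=
    { toLinearMap := g.toLinearMap ∘ₗ h.toLinearMap
      map_br := fun x => (congrArg g.toLinearMap (h.map_br' x)).trans (g.map_br' _) }
  have : gh.toLinearMap = f.toLinearMap := Free.hom_ext fun x => hs _
  exact ⟨h, fun u => LinearMap.congr_fun this u⟩

/-- The `2`-nilpotent multiplier does not depend on the free presentation. -/
theorem multiplier_iso (π : Hom K n (Free K n X) L) (ρ : Hom K n (Free K n Y) L)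
    (hπ : Function.Surjective π.toLinearMap) (hρ : Function.Surjective ρ.toLinearMap) :
    Nonempty (Iso K n (Multiplier 2 π) (Multiplier 2 ρ)) := by
  obtain ⟨f, hf⟩ := Free.exists_lift π ρ hρ
  obtain ⟨g, hg⟩ := Free.exists_lift ρ π hπ
  have hfk : ∀ u ∈ π.ker.toSubmodule, f.toLinearMap u ∈ ρ.ker.toSubmodule := fun u hu =>
    LinearMap.mem_ker.2 ((hf u).trans hu)
  have hgk : ∀ u ∈ ρ.ker.toSubmodule, g.toLinearMap u ∈ π.ker.toSubmodule := fun u hu =>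
    LinearMap.mem_ker.2 ((hg u).trans hu)
  have hft := f.map_gamma (I := Ideal.top) (J := Ideal.top) (fun _ _ => Submodule.mem_top) 2
  have hgt := g.map_gamma (I := Ideal.top) (J := Ideal.top) (fun _ _ => Submodule.mem_top) 2
  refine ⟨sectionIso f g _ _ _ _ (fun u hu => ⟨hfk u hu.1, hft u hu.2⟩) (f.map_gamma hfk 2)
    (fun u hu => ⟨hgk u hu.1, hgt u hu.2⟩) (g.map_gamma hgk 2) (fun u hu => ?_) fun u hu => ?_⟩
  -- The composite lies over the identity of `L`, so it differs from the identity by elements of the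
  -- kernel.
  · refine Hom.sub_mem_gamma_two
      { toLinearMap := g.toLinearMap ∘ₗ f.toLinearMap
        map_br := fun x => (congrArg g.toLinearMap (f.map_br' x)).trans (g.map_br' _) }
      π.ker (fun v => LinearMap.mem_ker.2 ?_) u hu.2
    rw [map_sub, LinearMap.comp_apply, hg, hf, sub_self]
  · refine Hom.sub_mem_gamma_two
      { toLinearMap := f.toLinearMap ∘ₗ g.toLinearMap
        map_br := fun x => (congrArg f.toLinearMap (g.map_br' x)).trans (f.map_br' _) }
      ρ.ker (fun v => LinearMap.mem_ker.2 ?_) u hu.2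
    rw [map_sub, LinearMap.comp_apply, hf, hg, sub_self]

/-- If the kernel of a presentation is `F³`, then the `2`-nilpotent multiplier is `F³ / F⁵`. -/
theorem multiplier_iso_section (ρ : Hom K n (Free K n Y) L)
    (h : ρ.ker.toSubmodule = (lowerCentral K n (Free K n Y) 3).toSubmodule) :
    Nonempty (Iso K n (Multiplier 2 ρ)
      ((lowerCentral K n (Free K n Y) 3).Section (lowerCentral K n (Free K n Y) 5))) := by
  have h' : ρ.ker = lowerCentral K n (Free K n Y) 3 := Ideal.ext' h
  let i : Hom K n (Free K n Y) (Free K n Y) := { toLinearMap := LinearMap.id, map_br := fun _ => rfl }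
  refine ⟨sectionIso i i _ _ _ _ (fun u hu => hu.2) (fun u hu => ?_)
    (fun u hu => ⟨h.symm ▸ hu, hu⟩) (fun u hu => ?_) (fun u _ => ?_) fun u _ => ?_⟩
  · rw [h'] at hu; exact hu
  · rw [h']; exact hu
  · exact (sub_self u).symm ▸ Submodule.zero_mem _
  · exact (sub_self u).symm ▸ Submodule.zero_mem _

end Multiplier

/-! ### A determinant model of an `n`-Lie algebra. -/

section DetAlgebra

variable (K : Type*) (n : ℕ) [NeZero n] [Field K] (A : Type*) [CommRing A] [Algebra K A]

/-- The `n`-Lie algebra `Aⁿ` over a commutative algebra `A`, with the bracket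
`[a₁, …, aₙ] = det (a₁, …, aₙ) • t` for a fixed vector `t`. -/
def DetAlgebra {n : ℕ} {A : Type*} (_t : Fin n → A) : Type _ := Fin n → A

variable {n A} (t : Fin n → A)

instance : AddCommGroup (DetAlgebra t) := inferInstanceAs (AddCommGroup (Fin n → A))

instance : Module K (DetAlgebra t) := inferInstanceAs (Module K (Fin n → A))

omit [NeZero n] in
-- Cramer's rule for the transposed matrix. It is exactly what makes the determinant bracket satisfy
-- the Filippov identity.
theorem sum_det_updateRow_smul (a : Matrix (Fin n) (Fin n) A) (t : Fin n → A) :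
    ∑ i, (a.updateRow i t).det • a i = a.det • t := by
  have h := Matrix.mulVec_cramer a.transpose t
  rw [Matrix.det_transpose] at h
  rw [← h]
  funext k
  simp only [Matrix.mulVec, dotProduct, Matrix.cramer_transpose_apply, Finset.sum_apply,
    Pi.smul_apply, smul_eq_mul, Matrix.transpose_apply]
  exact Finset.sum_congr rfl fun i _ => mul_comm _ _

noncomputable instance : NLieAlgebra K n (DetAlgebra t) where
  bracket :=
    { toFun := fun a => (Matrix.detRowAlternating (R := A) (n := Fin n) a • t : Fin n → A)
      map_update_add' := by
        intro inst a i u v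
        obtain rfl := Subsingleton.elim inst (instDecidableEqFin n)
        have h := (Matrix.detRowAlternating (R := A) (n := Fin n)).map_update_add a i u v
        exact (congrArg (· • t) h).trans (add_smul _ _ _)
      map_update_smul' := by
        intro inst a i k u
        obtain rfl := Subsingleton.elim inst (instDecidableEqFin n)
        have h := ((Matrix.detRowAlternating (R := A)
          (n := Fin n)).toMultilinearMap.restrictScalars K).map_update_smul a i k u
        exact (congrArg (· • t) h).trans (funext fun _ => smul_mul_assoc _ _ _)
      map_eq_zero_of_eq' := by
        intro a i j h hij
        have h := (Matrix.detRowAlternating (R := A) (n := Fin n)).map_eq_zero_of_eq a h hij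
        exact (congrArg (· • t) h).trans (zero_smul _ _) }
  filippov := by
    intro x y
    let D : (Fin n → A) →ₗ[A] A :=
      (Matrix.detRowAlternating (R := A) (n := Fin n)).toMultilinearMap.toLinearMap y 0
    let E : Fin n → (Fin n → A) →ₗ[A] A := fun i =>
      (Matrix.detRowAlternating (R := A) (n := Fin n)).toMultilinearMap.toLinearMap x i
    change @Eq (Fin n → A) (D (Matrix.det x • t) • t) (∑ i, E i (D (x i) • t) • t)
    -- Both sides of the identity are `D` applied to the two sides of Cramer's rule, by
    -- `A`-linearity of `D` and `E i`.
    have h : ∑ i, E i t • (id (x i) : Fin n → A) = Matrix.det x • t := sum_det_updateRow_smul x t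
    rw [← Finset.sum_smul, ← h, map_sum]
    simp only [map_smul, smul_eq_mul]
    congr 1
    exact Finset.sum_congr rfl fun i _ => mul_comm _ _

theorem DetAlgebra.br_eq (a : Fin n → DetAlgebra t) :
    br K a = (Matrix.det (fun i => (a i : Fin n → A)) • t : Fin n → A) := rfl

omit [NeZero n] in
-- Every term of the Leibniz expansion has one factor from row `r`.
theorem det_mem_of_row_mem (I : _root_.Ideal A) (M : Matrix (Fin n) (Fin n) A) (r : Fin n)
    (h : ∀ k, M r k ∈ I) : M.det ∈ I := by
  rw [Matrix.det_apply']
  refine Submodule.sum_mem _ fun σ _ => I.mul_mem_left _ ?_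
  rw [← Finset.mul_prod_erase _ _ (Finset.mem_univ (σ.symm r)), Equiv.apply_symm_apply]
  exact I.mul_mem_right _ (h _)

omit [NeZero n] in
theorem det_update_single (j : Fin n) (b : Fin n → A) :
    Matrix.det (Function.update (fun i => (Pi.single i 1 : Fin n → A)) j b) = b j := by
  have e : (fun i => (Pi.single i 1 : Fin n → A)) = (1 : Matrix (Fin n) (Fin n) A) := by
    funext i k
    rw [Matrix.one_apply, Pi.single_apply]
    simp only [eq_comm]
  have h := Matrix.cramer_transpose_apply (1 : Matrix (Fin n) (Fin n) A) b j
  rw [Matrix.transpose_one, Matrix.cramer_one] at h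
  rw [e]
  exact h.symm

end DetAlgebra

/-! ### Spanning words for `F³ / F⁵`. -/

section Span

variable {K : Type*} {n : ℕ} [NeZero n] [Field K]

namespace Free

/-- The word `[x₁, …, xₙ]` in the letters. -/
noncomputable def word : Free K n (Fin n) := br K Free.of

/-- The operator replacing the letter `x_j` in `[x₁, …, xₙ]` by its argument. -/
noncomputable def op (j : Fin n) : Free K n (Fin n) →ₗ[K] Free K n (Fin n) :=
  brLin Free.of j

theorem op_apply (j : Fin n) (u : Free K n (Fin n)) :
    op j u = br K (Function.update Free.of j u) := rfl

theorem op_of_self (j : Fin n) : op j (of j : Free K n (Fin n)) = word := by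
  rw [op_apply, Function.update_eq_self, word]

theorem op_of_ne {i j : Fin n} (h : i ≠ j) : op j (of i : Free K n (Fin n)) = 0 := by
  rw [op_apply]
  exact br_eq_zero_of_eq _ (i := i) (j := j) (by simp [h]) h

/-- Expand `op j` of the bracket `op i word` by the Filippov identity. Position `i` gives `op i (op
j word)`. Position `j` would carry `word` a second time, so alternation kills it. Every other letter
is killed by `op j`. -/
theorem op_comm (i j : Fin n) :
    op j (op i (word : Free K n (Fin n))) = op i (op j word) := by
  rcases eq_or_ne i j with rfl | hij
  · rfl
  rw [op_apply j, op_apply i word, filippov_at, Finset.sum_eq_single i]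
  · rw [Function.update_self, Function.update_idem]
    rfl
  · intro l _ hl
    rw [Function.update_of_ne hl, ← op_apply]
    rcases eq_or_ne l j with rfl | hlj
    · rw [op_of_self]
      exact br_eq_zero_of_eq _ (i := i) (j := l) (by simp [hij]) hij
    · rw [op_of_ne hlj]
      exact map_zero (brLin (K := K) _ l)
  · exact fun h => absurd (Finset.mem_univ i) h

theorem top_le : ⊤ ≤ Submodule.span K (Set.range (of : Fin n → Free K n (Fin n))) ⊔
    (Ideal.top : Ideal K n (Free K n (Fin n))).comm.toSubmodule := by
  intro q hq
  clear hq
  induction q using ind with | h a =>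
  induction a with
  | of x => exact Submodule.mem_sup_left (Submodule.subset_span ⟨x, rfl⟩)
  | zero => exact Submodule.zero_mem _
  | add a b iha ihb => exact Submodule.add_mem _ iha ihb
  | smul k a ih => exact Submodule.smul_mem _ k ih
  | brk x _ =>
    rw [← br_mk]
    exact Submodule.mem_sup_right (Ideal.br_mem_comm _ _ 0 Submodule.mem_top)

/-- Only `n - 1` positions carry letters, so some letter `j` is absent. Either a letter repeats and
the bracket is zero, or the entries are a permutation of those of `op j u`. -/
theorem br_update_of_mem (σ : Fin n → Fin n) (u : Free K n (Fin n)) :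
    br K (Function.update (of ∘ σ) 0 u) ∈ Submodule.span K (Set.range fun j => op j u) := by
  obtain ⟨j, hj⟩ : ∃ j, ∀ i, i ≠ 0 → σ i ≠ j := by
    by_contra! h
    have h1 : (Finset.univ : Finset (Fin n)) ⊆ (Finset.univ.erase 0).image σ := fun j _ => by
      obtain ⟨i, hi, e⟩ := h j
      exact Finset.mem_image.2 ⟨i, by simpa using hi, e⟩
    have h2 := (Finset.card_le_card h1).trans Finset.card_image_le
    rw [Finset.card_erase_of_mem (Finset.mem_univ _), Finset.card_univ, Fintype.card_fin] at h2
    have := NeZero.pos n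
    omega
  by_cases hσ : ∃ i k, i ≠ k ∧ i ≠ 0 ∧ k ≠ 0 ∧ σ i = σ k
  · obtain ⟨i, k, hik, hi, hk, e⟩ := hσ
    rw [br_eq_zero_of_eq _ (i := i) (j := k) (by simp [hi, hk, e]) hik]
    exact Submodule.zero_mem _
  push Not at hσ
  have hinj : Function.Injective (Function.update σ 0 j) := by
    intro a b hab
    by_contra hne
    by_cases ha : a = 0
    · subst ha
      rw [Function.update_self, Function.update_of_ne (Ne.symm hne)] at hab
      exact hj b (Ne.symm hne) hab.symm
    · rw [Function.update_of_ne ha] at hab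
      by_cases hb : b = 0
      · subst hb
        rw [Function.update_self] at hab
        exact hj a ha hab
      · rw [Function.update_of_ne hb] at hab
        exact hσ a b hne ha hb hab
  let τ : Equiv.Perm (Fin n) := Equiv.ofBijective _ (Finite.injective_iff_bijective.1 hinj)
  have e : Function.update (of ∘ σ) 0 u =
      Function.update (of : Fin n → Free K n (Fin n)) j u ∘ τ := by
    funext i
    by_cases hi : i = 0
    · subst hi
      have : τ 0 = j := by
        change Function.update σ 0 j 0 = j
        simp
      simp [this]
    · have : τ i = σ i := by
        change Function.update σ 0 j i = σ i
        simp [hi]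
      simp [this, hi, hj i hi]
  rw [e, br_perm]
  rcases Int.units_eq_one_or (Equiv.Perm.sign τ) with h | h <;> rw [h]
  · rw [one_smul]; exact Submodule.subset_span ⟨j, rfl⟩
  · rw [Units.neg_smul, one_smul]; exact Submodule.neg_mem _ (Submodule.subset_span ⟨j, rfl⟩)

/-- Modulo `[[I, F, …, F], F, …, F]`, the ideal `[I, F, …, F]` is spanned by the values of the
operators `op j` on representatives of a spanning set of `I / [I, F, …, F]`. -/
theorem comm_le_span (I : Ideal K n (Free K n (Fin n))) (S : Set (Free K n (Fin n)))
    (hS : S ⊆ I.toSubmodule) (hI : I.toSubmodule ≤ Submodule.span K S ⊔ I.comm.toSubmodule) :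
    I.comm.toSubmodule ≤
      Submodule.span K {z | ∃ u ∈ S, ∃ j, op j u = z} ⊔ I.comm.comm.toSubmodule := by
  set W := Submodule.span K {z | ∃ u ∈ S, ∃ j, op j u = z} ⊔ I.comm.comm.toSubmodule with hW
  -- Induction on a set `s` of positions whose entries may fail to be letters. Each such entry is a
  -- combination of letters plus an element of `F²`, and the latter contributes only to `[[I, F, …,
  -- F], F, …, F]`.
  have key : ∀ (s : Finset (Fin n)) (x : Fin n → Free K n (Fin n)), x 0 ∈ S →
      (∀ i ∉ s, i ≠ 0 → x i ∈ Set.range of) → br K x ∈ W := by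
    intro s
    induction s using Finset.induction_on with
    | empty =>
      intro x h0 hx
      have : ∀ i, ∃ l, i ≠ 0 → of l = x i := fun i => by
        by_cases hi : i = 0
        · exact ⟨0, fun h => absurd hi h⟩
        · obtain ⟨l, hl⟩ := hx i (by simp) hi
          exact ⟨l, fun _ => hl⟩
      choose σ hσ using this
      have e : x = Function.update (of ∘ σ) 0 (x 0) := by
        rw [Function.eq_update_iff]
        exact ⟨rfl, fun i hi => (hσ i hi).symm⟩
      rw [e]
      refine Submodule.mem_sup_left (Submodule.span_mono ?_ (br_update_of_mem σ (x 0)))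
      rintro _ ⟨j, rfl⟩
      exact ⟨_, h0, j, rfl⟩
    | insert i s _ ih =>
      intro x h0 hx
      by_cases hi : i = 0
      · exact ih x h0 fun l hl hl0 => hx l (by simp [hl, hi, hl0]) hl0
      have hle : ⊤ ≤ W.comap (brLin (K := K) x i) := by
        refine top_le.trans (sup_le (Submodule.span_le.2 ?_) fun u hu => ?_)
        · rintro _ ⟨l, rfl⟩
          refine ih _ (by rwa [Function.update_of_ne (Ne.symm hi)]) fun k hk hk0 => ?_
          by_cases hki : k = i
          · subst hki; simp
          · rw [Function.update_of_ne hki]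
            exact hx k (by simp [hki, hk]) hk0
        · refine Submodule.mem_sup_right (I.br_mem_comm_comm _ (i := 0) (j := i) (Ne.symm hi) ?_ ?_)
          · rw [Function.update_of_ne (Ne.symm hi)]; exact hS h0
          · rwa [Function.update_self]
      have := hle (Submodule.mem_top (x := x i))
      rwa [Submodule.mem_comap, brLin_apply, Function.update_eq_self] at this
  refine I.comm_le _ fun x hx => ?_
  have hle : I.toSubmodule ≤ W.comap (brLin (K := K) x 0) := by
    refine hI.trans (sup_le (Submodule.span_le.2 fun u hu => ?_) fun u hu => ?_)
    · refine key Finset.univ _ ?_ fun i hi => absurd (Finset.mem_univ i) hi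
      rwa [Function.update_self]
    · refine Submodule.mem_sup_right (Ideal.br_mem_comm _ _ 0 ?_)
      rwa [Function.update_self]
  have := hle hx
  rwa [Submodule.mem_comap, brLin_apply, Function.update_eq_self] at this

theorem word_mem : (word : Free K n (Fin n)) ∈
    (Ideal.top : Ideal K n (Free K n (Fin n))).comm.toSubmodule :=
  Ideal.br_mem_comm _ _ 0 Submodule.mem_top

theorem op_mem (I : Ideal K n (Free K n (Fin n))) (j : Fin n) {u : Free K n (Fin n)}
    (hu : u ∈ I.toSubmodule) : op j u ∈ I.comm.toSubmodule :=
  I.br_mem_comm _ j (by rwa [Function.update_self])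

theorem lowerCentral_two_le : (lowerCentral K n (Free K n (Fin n)) 2).toSubmodule ≤
    Submodule.span K {word} ⊔ (lowerCentral K n (Free K n (Fin n)) 3).toSubmodule := by
  refine (comm_le_span Ideal.top (Set.range of) (fun _ _ => Submodule.mem_top) top_le).trans
    (sup_le_sup_right (Submodule.span_le.2 ?_) _)
  rintro _ ⟨_, ⟨l, rfl⟩, j, rfl⟩
  rcases eq_or_ne l j with rfl | h
  · rw [op_of_self]; exact Submodule.mem_span_singleton_self _
  · rw [op_of_ne h]; exact Submodule.zero_mem _

theorem lowerCentral_three_le : (lowerCentral K n (Free K n (Fin n)) 3).toSubmodule ≤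
    Submodule.span K (Set.range fun j => op j word) ⊔
      (lowerCentral K n (Free K n (Fin n)) 4).toSubmodule := by
  refine (comm_le_span Ideal.top.comm {word} (Set.singleton_subset_iff.2 word_mem)
    lowerCentral_two_le).trans (sup_le_sup_right (Submodule.span_mono ?_) _)
  rintro _ ⟨_, rfl, j, rfl⟩
  exact ⟨j, rfl⟩

theorem lowerCentral_four_le : (lowerCentral K n (Free K n (Fin n)) 4).toSubmodule ≤
    Submodule.span K (Set.range fun p : Fin n × Fin n => op p.1 (op p.2 word)) ⊔
      (lowerCentral K n (Free K n (Fin n)) 5).toSubmodule := by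
  refine (comm_le_span Ideal.top.comm.comm (Set.range fun j => op j word)
    (Set.range_subset_iff.2 fun j => op_mem _ j word_mem)
    lowerCentral_three_le).trans (sup_le_sup_right (Submodule.span_mono ?_) _)
  rintro _ ⟨_, ⟨i, rfl⟩, j, rfl⟩
  exact ⟨(j, i), rfl⟩

/-- Words of weight `3` and `4`. -/
noncomputable def words : Fin n ⊕ Sym2 (Fin n) → Free K n (Fin n) :=
  Sum.elim (fun j => op j word)
    (Sym2.lift ⟨fun i j => op i (op j word), fun i j => op_comm j i⟩)

theorem words_mem (k : Fin n ⊕ Sym2 (Fin n)) :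
    words k ∈ (lowerCentral K n (Free K n (Fin n)) 3).toSubmodule := by
  rcases k with j | s
  · exact op_mem _ j word_mem
  · induction s using Sym2.ind with | _ i j =>
    exact Ideal.comm_le_self _ (op_mem _ i (op_mem _ j word_mem))

theorem lowerCentral_three_le_words : (lowerCentral K n (Free K n (Fin n)) 3).toSubmodule ≤
    Submodule.span K (Set.range words) ⊔
      (lowerCentral K n (Free K n (Fin n)) 5).toSubmodule := by
  refine lowerCentral_three_le.trans (sup_le ((Submodule.span_mono ?_).trans le_sup_left)
    (lowerCentral_four_le.trans (sup_le_sup_right (Submodule.span_mono ?_) _)))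
  · rintro _ ⟨j, rfl⟩
    exact ⟨Sum.inl j, rfl⟩
  · rintro _ ⟨⟨i, j⟩, rfl⟩
    exact ⟨Sum.inr s(i, j), rfl⟩

end Free

end Span

/-! ### The determinant representation of the free algebra. -/

section Independence

variable {K : Type*} {n : ℕ} [NeZero n] [Field K]

open MvPolynomial

/-- The homomorphism to `K[X₁, …, Xₙ]ⁿ` sending the letters to the standard basis. -/
noncomputable def Free.toDet :
    Hom K n (Free K n (Fin n)) (DetAlgebra (X : Fin n → MvPolynomial (Fin n) K)) :=
  Free.lift fun i => (Pi.single i 1 : Fin n → MvPolynomial (Fin n) K)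

theorem Free.toDet_word : (Free.toDet (K := K) (n := n)).toLinearMap Free.word =
    (X : Fin n → MvPolynomial (Fin n) K) := by
  rw [Free.word, Hom.map_br', DetAlgebra.br_eq]
  have h := det_update_single (0 : Fin n) (Pi.single 0 1 : Fin n → MvPolynomial (Fin n) K)
  rw [Function.update_eq_self (0 : Fin n)
    (fun i => (Pi.single i 1 : Fin n → MvPolynomial (Fin n) K)), Pi.single_eq_same] at h
  exact (congrArg (· • X) h).trans (one_smul _ _)

/-- The identity matrix with row `j` replaced by `p • X` has determinant `p * X j`. -/
theorem Free.toDet_op (j : Fin n) (u : Free K n (Fin n)) (p : MvPolynomial (Fin n) K)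
    (hu : (Free.toDet (K := K) (n := n)).toLinearMap u =
      (p • X : Fin n → MvPolynomial (Fin n) K)) :
    (Free.toDet (K := K) (n := n)).toLinearMap (Free.op j u) =
      ((p * X j) • X : Fin n → MvPolynomial (Fin n) K) := by
  rw [Free.op_apply, Hom.map_br', DetAlgebra.br_eq]
  have e : (fun i => (Free.toDet (K := K) (n := n)).toLinearMap
      (Function.update Free.of j u i)) =
      Function.update (fun i => (Pi.single i 1 : Fin n → MvPolynomial (Fin n) K)) j (p • X) := by
    funext i
    by_cases hi : i = j
    · subst hi; rw [Function.update_self, Function.update_self, hu]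
    · rw [Function.update_of_ne hi, Function.update_of_ne hi]; rfl
  exact congrArg (· • X) ((congrArg Matrix.det e).trans (det_update_single j _))

/-- Each bracket with an entry whose coordinates lie in the `k`-th power has determinant in that
power, and the factor `X` raises the exponent by one. Here `gamma k` is `F^{k+1}`, so `F⁵`
corresponds to exponent 4. -/
theorem Free.toDet_gamma (k : ℕ) (u : Free K n (Fin n))
    (hu : u ∈ ((Ideal.top : Ideal K n (Free K n (Fin n))).gamma k).toSubmodule) (i : Fin n) :
    ((Free.toDet (K := K) (n := n)).toLinearMap u : Fin n → MvPolynomial (Fin n) K) i ∈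
      idealOfVars (Fin n) K ^ k := by
  let J : _root_.Ideal (MvPolynomial (Fin n) K) → Submodule K (DetAlgebra
    (X : Fin n → MvPolynomial (Fin n) K)) := fun I => Submodule.pi Set.univ fun _ => I.restrictScalars K
  induction k generalizing u i with
  | zero => simp
  | succ k ih =>
    have hle : ((Ideal.top : Ideal K n (Free K n (Fin n))).gamma (k + 1)).toSubmodule ≤
        (J (idealOfVars (Fin n) K ^ (k + 1))).comap Free.toDet.toLinearMap := by
      refine Ideal.comm_le _ _ fun x hx => ?_
      rw [Submodule.mem_comap, Hom.map_br', DetAlgebra.br_eq]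
      refine fun i _ => ?_
      change _ * X i ∈ idealOfVars (Fin n) K ^ (k + 1)
      rw [pow_succ]
      refine Ideal.mul_mem_mul ?_ (Ideal.subset_span ⟨i, rfl⟩)
      exact det_mem_of_row_mem _ _ 0 (ih (x 0) hx)
    exact hle hu i (Set.mem_univ i)

end Independence

/-! ### Linear independence and the basis of `F³ / F⁵`. -/

section Dimension

variable {K : Type*} {n : ℕ} [NeZero n] [Field K]

open MvPolynomial

/-- The multiset of letters by which a word in `Free.words` differs from `[x₁, …, xₙ]`. -/
def Free.letters : Fin n ⊕ Sym2 (Fin n) → Multiset (Fin n) :=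
  Sum.elim (fun j => {j}) Sym2.toMultiset

omit [NeZero n] in
-- Cardinality separates the two weights. This injectivity makes the monomials attached to the words
-- distinct.
theorem Free.letters_injective : Function.Injective (Free.letters (n := n)) := by
  rintro (i | s) (j | t) h
  · exact congrArg Sum.inl (Multiset.singleton_inj.1 h)
  · have := congrArg Multiset.card h
    simp [letters, Sym2.card_toMultiset] at this
  · have := congrArg Multiset.card h
    simp [letters, Sym2.card_toMultiset] at this
  · refine congrArg Sum.inr (Sym2.ext fun x => ?_)
    rw [← Sym2.mem_toMultiset, ← Sym2.mem_toMultiset]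
    exact iff_of_eq (congrArg (x ∈ ·) h)

omit [NeZero n] in
theorem Free.card_letters_le (k : Fin n ⊕ Sym2 (Fin n)) : (Free.letters k).card ≤ 2 := by
  rcases k with i | s <;> simp [letters, Sym2.card_toMultiset]

theorem Free.toDet_words (k : Fin n ⊕ Sym2 (Fin n)) :
    (Free.toDet (K := K) (n := n)).toLinearMap (Free.words k) =
      (monomial (Multiset.toFinsupp (Free.letters k)) (1 : K) • X :
        Fin n → MvPolynomial (Fin n) K) := by
  have h1 : (Free.toDet (K := K) (n := n)).toLinearMap Free.word =
      ((1 : MvPolynomial (Fin n) K) • X : Fin n → MvPolynomial (Fin n) K) := by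
    rw [one_smul]; exact Free.toDet_word
  rcases k with j | s
  · refine (Free.toDet_op j _ _ h1).trans ?_
    have : Free.letters (Sum.inl j) = {j} := rfl
    rw [this, one_mul, Multiset.toFinsupp_singleton, X]
  · induction s using Sym2.ind with | _ i j =>
    refine (Free.toDet_op i _ _ (Free.toDet_op j _ _ h1)).trans ?_
    have : (Free.letters (Sum.inr s(i, j))) = {i} + {j} := rfl
    rw [this, map_add, one_mul, Multiset.toFinsupp_singleton, Multiset.toFinsupp_singleton, X, X,
      monomial_mul, one_mul, add_comm]

/-- The classes of `Free.words` in `F³ / F⁵`. -/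
noncomputable def Free.wordClass (k : Fin n ⊕ Sym2 (Fin n)) :
    (lowerCentral K n (Free K n (Fin n)) 3).Section (lowerCentral K n (Free K n (Fin n)) 5) :=
  Submodule.Quotient.mk ⟨Free.words k, Free.words_mem k⟩

theorem Free.linearIndependent_wordClass :
    LinearIndependent K (Free.wordClass (K := K) (n := n)) := by
  rw [Fintype.linearIndependent_iff]
  intro a ha k
  have h1 : ∑ k, a k • Free.words k ∈ (lowerCentral K n (Free K n (Fin n)) 5).toSubmodule := by
    have h2 : (Submodule.Quotient.mk (∑ k, a k • ⟨Free.words k, Free.words_mem k⟩) :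
        (lowerCentral K n (Free K n (Fin n)) 3).Section
          (lowerCentral K n (Free K n (Fin n)) 5)) = 0 := by
      rw [← ha, ← Submodule.mkQ_apply, map_sum]
      simp only [map_smul]
      rfl
    rw [Submodule.Quotient.mk_eq_zero] at h2
    have h3 : ((∑ k, a k • (⟨Free.words k, Free.words_mem k⟩ :
        (lowerCentral K n (Free K n (Fin n)) 3).toSubmodule) :
        (lowerCentral K n (Free K n (Fin n)) 3).toSubmodule) : Free K n (Fin n)) ∈
        (lowerCentral K n (Free K n (Fin n)) 5).toSubmodule := h2
    simpa using h3
  -- One coordinate is enough: coordinate `0` of the image is the combination of monomials times `X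
  -- 0`.
  have h4 := Free.toDet_gamma 4 _ h1 0
  let coord : DetAlgebra (X : Fin n → MvPolynomial (Fin n) K) →ₗ[K] MvPolynomial (Fin n) K :=
    LinearMap.proj (R := K) (φ := fun _ : Fin n => MvPolynomial (Fin n) K) 0
  have h5 : coord ((Free.toDet (K := K) (n := n)).toLinearMap (∑ k, a k • Free.words k)) =
      (∑ k, a k • monomial (Multiset.toFinsupp (Free.letters k)) (1 : K)) * X 0 := by
    rw [map_sum, map_sum, Finset.sum_mul]
    refine Finset.sum_congr rfl fun k _ => ?_
    rw [map_smul, map_smul, Free.toDet_words]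
    exact (smul_mul_assoc _ _ _).symm
  replace h4 : coord ((Free.toDet (K := K) (n := n)).toLinearMap (∑ k, a k • Free.words k)) ∈
    idealOfVars (Fin n) K ^ 4 := h4
  rw [h5, mem_pow_idealOfVars_iff'] at h4
  -- This monomial has degree at most `2 + 1 < 4`, so its coefficient vanishes; that coefficient is
  -- `a k`.
  have h6 := h4 (Multiset.toFinsupp (Free.letters k) + Finsupp.single 0 1) (by
    have := Free.card_letters_le k
    have h7 : Finsupp.degree (Multiset.toFinsupp (Free.letters k)) = (Free.letters k).card :=
      Multiset.toFinsupp_sum_eq _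
    rw [map_add, h7, Finsupp.degree_single]
    omega)
  rw [coeff_mul_X, coeff_sum, Finset.sum_eq_single k] at h6
  · simpa using h6
  · intro l _ hl
    rw [coeff_smul, coeff_monomial, if_neg, smul_zero]
    exact fun h => hl (Free.letters_injective (Multiset.toFinsupp.injective h))
  · exact fun h => absurd (Finset.mem_univ k) h

theorem Free.top_le_span_wordClass :
    ⊤ ≤ Submodule.span K (Set.range (Free.wordClass (K := K) (n := n))) := by
  rintro q -
  induction q using Submodule.Quotient.induction_on with | H u =>
  obtain ⟨v, hv, w, hw, hu⟩ := Submodule.mem_sup.1 (Free.lowerCentral_three_le_words u.2)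
  obtain ⟨a, rfl⟩ := (Submodule.mem_span_range_iff_exists_fun K).1 hv
  have e : (Submodule.Quotient.mk u : (lowerCentral K n (Free K n (Fin n)) 3).Section
      (lowerCentral K n (Free K n (Fin n)) 5)) = ∑ k, a k • Free.wordClass k := by
    have : ∑ k, a k • Free.wordClass k = (Submodule.Quotient.mk
        (∑ k, a k • ⟨Free.words k, Free.words_mem k⟩) :
        (lowerCentral K n (Free K n (Fin n)) 3).Section
          (lowerCentral K n (Free K n (Fin n)) 5)) := by
      rw [← Submodule.mkQ_apply, map_sum]
      simp only [map_smul]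
      rfl
    rw [this, Submodule.Quotient.eq]
    change (u : Free K n (Fin n)) - ((∑ k, a k • (⟨Free.words k, Free.words_mem k⟩ :
        (lowerCentral K n (Free K n (Fin n)) 3).toSubmodule) :
        (lowerCentral K n (Free K n (Fin n)) 3).toSubmodule) : Free K n (Fin n)) ∈
        (lowerCentral K n (Free K n (Fin n)) 5).toSubmodule
    rw [← hu]
    simpa using hw
  rw [e]
  exact Submodule.sum_mem _ fun k _ => Submodule.smul_mem _ _ (Submodule.subset_span ⟨k, rfl⟩)

omit [NeZero n] in
theorem card_words : Fintype.card (Fin n ⊕ Sym2 (Fin n)) = (n ^ 2 + 3 * n) / 2 := by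
  rw [Fintype.card_sum, Sym2.card, Fintype.card_fin, Nat.choose_two_right, Nat.add_sub_cancel,
    ← Nat.mul_add_div (by norm_num)]
  congr 1
  ring

variable (K n) in
/-- The basis of `F³ / F⁵` given by the words of weight `3` and `4`. -/
noncomputable def Free.sectionBasis : Module.Basis (Fin ((n ^ 2 + 3 * n) / 2)) K
    ((lowerCentral K n (Free K n (Fin n)) 3).Section (lowerCentral K n (Free K n (Fin n)) 5)) :=
  (Module.Basis.mk Free.linearIndependent_wordClass Free.top_le_span_wordClass).reindex
    (Fintype.equivFinOfCardEq card_words)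

end Dimension

/-! ### The presentation `F / F³` of a Heisenberg algebra. -/

section Heisenberg

variable {K : Type*} {n : ℕ} [NeZero n] [Field K]
variable {H : Type*} [AddCommGroup H] [Module K H] [NLieAlgebra K n H]

theorem br_eq_zero_of_mem_center (x : Fin n → H) (i : Fin n) (h : x i ∈ center K n H) :
    br K x = 0 := by
  rw [← Function.update_eq_self i x]
  by_cases hi : 0 = i
  · subst hi; exact h x
  · rw [br_update_swap x hi, h, neg_zero]

/-- On distinct basis vectors, either a central one occurs or the `n` remaining ones appear in some
order, so a single bracket determines all the others. -/
theorem br_eq_zero_of_basis {ι : Type*} (b : Module.Basis (Fin n ⊕ ι) K H)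
    (hb : ∀ i, b (Sum.inr i) ∈ center K n H) (h0 : br K (fun i => b (Sum.inl i)) = 0)
    (x : Fin n → H) : br K x = 0 := by
  have : NLieAlgebra.bracket (K := K) (n := n) (L := H) = 0 := by
    refine Module.Basis.ext_alternating b fun v hv => ?_
    change br K (fun i => b (v i)) = 0
    by_cases hc : ∃ i k, v i = Sum.inr k
    · obtain ⟨i, k, e⟩ := hc
      exact br_eq_zero_of_mem_center _ i (by rw [e]; exact hb k)
    · have : ∀ i, ∃ k, v i = Sum.inl k := fun i => by
        rcases e : v i with k | k
        · exact ⟨k, rfl⟩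
        · exact absurd ⟨i, k, e⟩ hc
      choose σ hσ using this
      have hinj : Function.Injective σ := fun i j h => hv (by rw [hσ, hσ, h])
      have e : (fun i => b (v i)) = (fun i => b (Sum.inl i)) ∘
          Equiv.ofBijective σ (Finite.injective_iff_bijective.1 hinj) :=
        funext fun i => congrArg b (hσ i)
      rw [e, br_perm, h0, smul_zero]
  exact congrArg (fun f : H [⋀^Fin n]→ₗ[K] H => f x) this

/-- A Heisenberg algebra of dimension `n + 1` is `F / F³` for the free algebra `F` on `n`
letters. -/
theorem IsHeisenberg.exists_presentation (hH : IsHeisenberg K n H)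
    (hdim : Module.finrank K H = n + 1) :
    ∃ ρ : Hom K n (Free K n (Fin n)) H, Function.Surjective ρ.toLinearMap ∧
      ρ.ker.toSubmodule = (lowerCentral K n (Free K n (Fin n)) 3).toSubmodule := by
  obtain ⟨hZ, h1⟩ := hH
  change (Ideal.top : Ideal K n H).comm.toSubmodule = _ at hZ
  change Module.finrank K (Ideal.top : Ideal K n H).comm.toSubmodule = 1 at h1
  have : Module.Finite K H := Module.finite_of_finrank_pos (by omega)
  -- The letters go to a basis of a complement `C` of `H² = Z(H)`, which has dimension `n`.
  obtain ⟨C, hC⟩ := Submodule.exists_isCompl (Ideal.top : Ideal K n H).comm.toSubmodule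
  have hCdim : Module.finrank K C = n := by
    have := Submodule.finrank_add_eq_of_isCompl hC
    omega
  let bC := Module.finBasisOfFinrankEq K C hCdim
  let bZ := Module.finBasisOfFinrankEq K _ h1
  let b : Module.Basis (Fin n ⊕ Fin 1) K H :=
    (bC.prod bZ).map (Submodule.prodEquivOfIsCompl C _ hC.symm)
  have hbl : ∀ i, b (Sum.inl i) = bC i := fun i => by simp [b]
  have hbr : ∀ i, b (Sum.inr i) = bZ i := fun i => by simp [b]
  -- If this bracket vanished, all brackets would, contradicting `dim H² = 1`. Hence it spans `H²`.
  have hw0 : br K (fun i => b (Sum.inl i)) ≠ 0 := by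
    intro h0
    have h2 : (Ideal.top : Ideal K n H).comm.toSubmodule = ⊥ := le_bot_iff.1 <|
      Ideal.comm_le _ _ fun x _ => (Submodule.mem_bot K).2
        (br_eq_zero_of_basis b (fun i => by rw [hbr, ← hZ]; exact (bZ i).2) h0 x)
    rw [h2, finrank_bot] at h1
    exact zero_ne_one h1
  let ρ : Hom K n (Free K n (Fin n)) H := Free.lift fun i => b (Sum.inl i)
  have hρ : ∀ i, ρ.toLinearMap (Free.of i) = b (Sum.inl i) := fun _ => rfl
  have hρw : ρ.toLinearMap Free.word = br K (fun i => b (Sum.inl i)) := ρ.map_br' _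
  have hwZ : ρ.toLinearMap Free.word ∈ (Ideal.top : Ideal K n H).comm.toSubmodule := by
    rw [hρw]; exact Ideal.br_mem_comm _ _ 0 Submodule.mem_top
  have hw0' : (⟨_, hwZ⟩ : (Ideal.top : Ideal K n H).comm.toSubmodule) ≠ 0 := fun h =>
    hw0 (hρw.symm.trans (congrArg Subtype.val h))
  have hgamma : ∀ u ∈ (lowerCentral K n (Free K n (Fin n)) 3).toSubmodule,
      ρ.toLinearMap u = 0 := by
    have h2 : (Ideal.top : Ideal K n H).comm.comm.toSubmodule ≤ ⊥ := Ideal.comm_le _ _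
      fun x hx => (Submodule.mem_bot K).2 (br_eq_zero_of_mem_center x 0 (hZ ▸ hx))
    exact fun u hu => h2 (ρ.map_gamma (J := Ideal.top) (fun _ _ => Submodule.mem_top) 2 u hu)
  refine ⟨ρ, ?_, le_antisymm (fun u hu => ?_) fun u hu => ?_⟩
  · rw [← LinearMap.range_eq_top, ← top_le_iff, ← b.span_eq, Submodule.span_le]
    rintro _ ⟨i | i, rfl⟩
    · exact ⟨_, hρ i⟩
    · obtain ⟨k, hk⟩ := (finrank_eq_one_iff_of_nonzero' _ hw0').1 h1 (bZ i)
      refine ⟨k • Free.word, ?_⟩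
      rw [hbr, ← hk, map_smul]
      rfl
  · have hu0 : ρ.toLinearMap u = 0 := hu
    -- Modulo `F³`, `u` is a combination of letters plus a multiple of `word`. The two images lie in
    -- the complementary spaces `C` and `H²`, so each vanishes, and with it all coefficients.
    obtain ⟨v, hv, f, hf, rfl⟩ := Submodule.mem_sup.1 (Free.top_le (Submodule.mem_top (x := u)))
    obtain ⟨w, hw, g, hg, rfl⟩ := Submodule.mem_sup.1 (Free.lowerCentral_two_le hf)
    obtain ⟨a, rfl⟩ := (Submodule.mem_span_range_iff_exists_fun K).1 hv
    obtain ⟨k, rfl⟩ := Submodule.mem_span_singleton.1 hw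
    have hg0 := hgamma g hg
    rw [map_add, map_add, hg0, add_zero, map_smul, map_sum] at hu0
    simp only [map_smul, hρ, hbl] at hu0
    have hsum := Submodule.sum_mem C fun i (_ : i ∈ Finset.univ) => C.smul_mem (a i) (bC i).2
    have hkw : k • ρ.toLinearMap Free.word = 0 :=
      (Submodule.disjoint_def.1 hC.disjoint _ (Submodule.smul_mem _ k hwZ)
        (by rw [eq_neg_of_add_eq_zero_right hu0]; exact C.neg_mem hsum))
    rw [hkw, add_zero] at hu0
    have ha : ∀ i, a i = 0 := Fintype.linearIndependent_iff.1 bC.linearIndependent a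
      (Subtype.ext (by simpa using hu0))
    have hk : k = 0 := (smul_eq_zero.1 hkw).resolve_right fun h => hw0 (hρw.symm.trans h)
    simpa [ha, hk] using hg
  · exact hgamma u hu

end Heisenberg

/-! ### Evaluation of the counting formula for `d = n`. -/

section Count

/-- The search stops at `n - 2`, and `C(m, n-1) = 0` for `m ≤ n - 2`. So for `d = n` the outer sum
has the single term `j = 1`, with coefficient `n - n - 1 + 2 = 1`. -/
theorem jStar_self (n : ℕ) (hn : 2 ≤ n) : jStar n n 1 = 1 := by
  unfold jStar
  rw [Nat.choose_eq_zero_of_lt]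
  have := Nat.findGreatest_le (P := fun m => m.choose (n - 1) < 1) (n - 2)
  omega

theorem basicCount_three (n : ℕ) (hn : 2 ≤ n) : basicCount n n 3 = n := by
  have h : n.choose (n - 1) = n := by
    rw [Nat.choose_symm (by omega), Nat.choose_one_right]
  simp [basicCount, jStar_self n hn, h]

theorem basicCount_four (n : ℕ) (hn : 2 ≤ n) : basicCount n n 4 = n.choose 2 + n := by
  have h : n.choose (n - 1) = n := by
    rw [Nat.choose_symm (by omega), Nat.choose_one_right]
  have h2 : Finset.Icc 2 3 = {2, 3} := rfl
  simp [basicCount, jStar_self n hn, h, h2]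

theorem basicCount_add (n : ℕ) (hn : 2 ≤ n) :
    basicCount n n 3 + basicCount n n 4 = (((n ^ 2 + 3 * n) / 2 : ℕ) : ℤ) := by
  rw [basicCount_three n hn, basicCount_four n hn, Nat.choose_two_right]
  have h : (n ^ 2 + 3 * n) / 2 = n + (n * (n - 1) / 2 + n) := by
    obtain ⟨m, rfl⟩ : ∃ m, n = m + 1 := ⟨n - 1, by omega⟩
    have : (m + 1) ^ 2 + 3 * (m + 1) = 2 * (2 * (m + 1)) + (m + 1) * m := by ring
    rw [this, Nat.mul_add_div (by norm_num), Nat.add_sub_cancel]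
    ring
  rw [h]
  push_cast
  ring

end Count

end NLie

theorem mainTheorem3 {K : Type*} [Field K] (n : ℕ) [NeZero n] (hn : 2 ≤ n)
    (H : Type*) [AddCommGroup H] [Module K H] [NLieAlgebra K n H]
    (hH : NLie.IsHeisenberg K n H) (hdim : Module.finrank K H = n + 1)
    {X : Type*} (π : NLie.Hom K n (NLie.Free K n X) H)
    (hπ : Function.Surjective π.toLinearMap) :
    Nonempty (NLie.Iso K n (NLie.Multiplier 2 π) (NLie.Abelian K n ((n ^ 2 + 3 * n) / 2))) ∧
    Nonempty (NLie.Iso K n (NLie.Multiplier 2 π)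
      ((NLie.lowerCentral K n (NLie.Free K n (Fin n)) 3).Section
        (NLie.lowerCentral K n (NLie.Free K n (Fin n)) 5))) ∧
    (Module.finrank K ((NLie.lowerCentral K n (NLie.Free K n (Fin n)) 3).Section
        (NLie.lowerCentral K n (NLie.Free K n (Fin n)) 5)) : ℤ) =
      NLie.basicCount n n 3 + NLie.basicCount n n 4 ∧
    NLie.basicCount n n 3 + NLie.basicCount n n 4 = (((n ^ 2 + 3 * n) / 2 : ℕ) : ℤ) := by
  obtain ⟨ρ, hρ, hker⟩ := hH.exists_presentation hdim
  obtain ⟨e1⟩ := NLie.multiplier_iso π ρ hπ hρ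
  obtain ⟨e2⟩ := NLie.multiplier_iso_section ρ hker
  obtain ⟨e⟩ := e1.nonempty_trans e2
  -- Both brackets are zero, so equality of dimensions already gives an isomorphism of algebras.
  have eA : NLie.Iso K n ((NLie.lowerCentral K n (NLie.Free K n (Fin n)) 3).Section
      (NLie.lowerCentral K n (NLie.Free K n (Fin n)) 5))
      (NLie.Abelian K n ((n ^ 2 + 3 * n) / 2)) :=
    NLie.isoOfBrZero (NLie.Free.sectionBasis K n).equivFun (NLie.br_section_eq_zero hn)
      fun _ => rfl
  refine ⟨e.nonempty_trans eA, ⟨e⟩, ?_, NLie.basicCount_add n hn⟩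
  rw [NLie.basicCount_add n hn, Module.finrank_eq_card_basis (NLie.Free.sectionBasis K n),
    Fintype.card_fin]
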